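/- An \emph{effect algebra} is a set $E$ with an element $0$, a partial binary operation $\oplus$ and a total unary operation $x\mapsto x^\perp$ such that, writing $1 = 0^\perp$ and $x\perp y$ when $x\oplus y$ is defined: (i) if $x\perp y$ then $y\perp x$ and $x\oplus y=y\oplus x$; (ii) $x\perp 0$ and $x\oplus 0=x$; (iii) if $x\perp y$ and $(x\oplus y)\perp z$, then $y\perp z$, $x\perp(y\oplus z)$ and $(x\oplus y)\oplus z=x\oplus(y\oplus z)$; (iv) $x^\perp$ is the unique element with $x\oplus x^\perp=1$; (v) if $x\perp 1$ then $x=0$. It is partially ordered by $x\le y$ iff $x\oplus z=y$ for some $z$, and it is \emph{$\omega$-complete} if every increasing sequence $a_1\le a_2\le\cdots$ has a supremum. An \emph{effect monoid} is an effect algebra $M$ with a total associative binary operation $\cdot$ such that $a\cdot 1=a=1\cdot a$ and, whenever $b\perp c$, $a\cdot b\perp a\cdot c$, $b\cdot a\perp c\cdot a$, $a\cdot(b\oplus c)=(a\cdot b)\oplus(a\cdot c)$ and $(b\oplus c)\cdot a=(b\cdot a)\oplus(c\cdot a)$. A \emph{convex action} on an effect algebra $E$ is a map $[0,1]\times E\to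 E$, $(\lambda,a)\mapsto\lambda a$, where $[0,1]$ is the real unit interval, such that for all $\lambda,\mu\in[0,1]$ and $a,b\in E$: $\lambda(\mu a)=(\lambda\mu)a$; if $\lambda+\mu\le 1$ then $\lambda a\perp\mu a$ and $\lambda a\oplus\mu a=(\lambda+\mu)a$; if $a\perp b$ then $\lambda a\perp\lambda b$ and $\lambda(a\oplus b)=\lambda a\oplus\lambda b$; and $1a=a$. \textbf{Proposition.} Let $M$ be an $\omega$-complete effect monoid with a convex action of $[0,1]$ on its underlying effect algebra. Then for all $a,b\in M$ and $\lambda\in[0,1]$, $$\lambda(a\cdot b)=(\lambda a)\cdot b=a\cdot(\lambda b).$$ -/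

import Mathlib

/-- An effect algebra: a set with a distinguished element `0`, a partial binary operation `osum`
(`osum x y = none` means that the sum of `x` and `y` is not defined, `osum x y = some z` that it is
defined and equal to `z`) and a total complement `xᶜ`; the element `1` is `0ᶜ`. -/
class EffectAlgebra (E : Type*) extends Zero E, Compl E where
  /-- The partial sum. -/
  osum : E → E → Option E
  osum_comm : ∀ x y z : E, osum x y = some z → osum y x = some z
  osum_zero : ∀ x : E, osum x 0 = some x
  osum_assoc : ∀ x y z s t : E, osum x y = some s → osum s z = some t →
    ∃ u, osum y z = some u ∧ osum x u = some t
  osum_compl : ∀ x : E, osum x xᶜ = some 0ᶜ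
  eq_compl_of_osum : ∀ x y : E, osum x y = some 0ᶜ → y = xᶜ
  eq_zero_of_osum_one : ∀ x y : E, osum x 0ᶜ = some y → x = 0

namespace EffectAlgebra

instance instOne {E : Type*} [EffectAlgebra E] : One E := ⟨0ᶜ⟩

theorem eq_zero_of_osum_self {E : Type*} [EffectAlgebra E] {x u : E}
    (h : osum x u = some x) : u = 0 := by
  obtain ⟨v, hv, hv'⟩ := osum_assoc u x xᶜ x 0ᶜ (osum_comm _ _ _ h) (osum_compl x)
  rw [osum_compl] at hv
  cases hv
  exact eq_zero_of_osum_one u _ hv'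

theorem eq_zero_of_osum_eq_zero {E : Type*} [EffectAlgebra E] {a b : E}
    (h : osum a b = some 0) : b = 0 := by
  obtain ⟨v, hv, _⟩ := osum_assoc a b 0ᶜ 0 0ᶜ h (osum_comm _ _ _ (osum_zero _))
  exact eq_zero_of_osum_one b _ hv

/-- The order of an effect algebra: `x ≤ y` if and only if `y` is the sum of `x` and some `z`. -/
instance instPartialOrder {E : Type*} [EffectAlgebra E] : PartialOrder E where
  le x y := ∃ z, osum x z = some y
  le_refl x := ⟨0, osum_zero x⟩
  le_trans := by
    rintro x y z ⟨a, ha⟩ ⟨b, hb⟩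
    obtain ⟨u, _, hu⟩ := osum_assoc x a b y z ha hb
    exact ⟨u, hu⟩
  le_antisymm := by
    rintro x y ⟨a, ha⟩ ⟨b, hb⟩
    obtain ⟨u, hu, hu'⟩ := osum_assoc x a b y x ha hb
    rw [eq_zero_of_osum_self hu'] at hu
    rw [eq_zero_of_osum_eq_zero hu, osum_zero] at hb
    exact (Option.some.inj hb).symm

/-- Every increasing sequence has a supremum. -/
def IsOmegaComplete (E : Type*) [EffectAlgebra E] : Prop :=
  ∀ f : ℕ → E, Monotone f → ∃ s : E, IsLUB (Set.range f) s

end EffectAlgebra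

/-- An effect monoid: an effect algebra with a total, bi-additive, associative multiplication
whose unit is `1 = 0ᶜ`. -/
class EffectMonoid (M : Type*) extends EffectAlgebra M, Mul M where
  mul_unit : ∀ a : M, a * 1 = a
  unit_mul : ∀ a : M, 1 * a = a
  mul_osum : ∀ a b c d : M, osum b c = some d → osum (a * b) (a * c) = some (a * d)
  osum_mul : ∀ a b c d : M, osum b c = some d → osum (b * a) (c * a) = some (d * a)
  mul_mul : ∀ a b c : M, a * (b * c) = (a * b) * c

/-- A convex action of the real unit interval on an effect algebra. -/
class ConvexAction (E : Type*) [EffectAlgebra E] extends SMul unitInterval E where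
  smul_smul : ∀ (l m : unitInterval) (a : E), l • (m • a) = (l * m) • a
  osum_smul : ∀ (l m : unitInterval) (a : E) (h : (l : ℝ) + m ≤ 1),
    EffectAlgebra.osum (l • a) (m • a) =
      some ((⟨(l : ℝ) + m, add_nonneg l.2.1 m.2.1, h⟩ : unitInterval) • a)
  smul_osum : ∀ (l : unitInterval) (a b c : E), EffectAlgebra.osum a b = some c →
    EffectAlgebra.osum (l • a) (l • b) = some (l • c)
  one_smul : ∀ a : E, (1 : unitInterval) • a = a

/-! For fixed `a` and `b`, the three expressions are additive maps of the scalar from the unit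
interval to `M`, and all equal `a * b` at `1`. It suffices that such a map is determined by its
value at `1` (`additive_ext`). On dyadic scalars this holds because halves are unique under a convex
action (`osum_self_injective`). For other scalars, `ω`-completeness leaves no nonzero element below
all successive halves (`eq_zero_of_le_halves`), so an additive map is the supremum of its values at
dyadic approximations from below. -/

/-- The element `m / 2 ^ k` of the unit interval. -/
noncomputable def unitInterval.dyadic (m k : ℕ) (h : m ≤ 2 ^ k) : unitInterval :=
  ⟨(m : ℝ) / 2 ^ k, by positivity, by
    rw [div_le_one (by positivity)]
    exact_mod_cast h⟩

namespace EffectAlgebra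

variable {E : Type*} [EffectAlgebra E]

theorem osum_assoc' {x y z u t : E} (h : osum y z = some u) (h' : osum x u = some t) :
    ∃ s, osum x y = some s ∧ osum s z = some t := by
  obtain ⟨v, hv, hv'⟩ := osum_assoc z y x u t (osum_comm _ _ _ h) (osum_comm _ _ _ h')
  exact ⟨v, osum_comm _ _ _ hv, osum_comm _ _ _ hv'⟩

/-- Any `w` with `x ⊕ w = t` is the complement of `tᶜ ⊕ x`, which does not depend on `w`. -/
theorem osum_left_cancel {x y z t : E} (h : osum x y = some t) (h' : osum x z = some t) :
    y = z := by
  have key : ∀ w : E, osum x w = some t → ∃ v, osum tᶜ x = some v ∧ w = vᶜ := by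
    intro w hw
    obtain ⟨v, hv, hv'⟩ := osum_assoc' hw (osum_comm _ _ _ (osum_compl t))
    exact ⟨v, hv, eq_compl_of_osum _ _ hv'⟩
  obtain ⟨v, hv, rfl⟩ := key y h
  obtain ⟨v', hv', rfl⟩ := key z h'
  rw [hv] at hv'
  cases hv'
  rfl

theorem le_of_osum_left {x y z : E} (h : osum x y = some z) : x ≤ z := ⟨y, h⟩

theorem le_of_osum_right {x y z : E} (h : osum x y = some z) : y ≤ z := ⟨x, osum_comm _ _ _ h⟩

theorem exists_osum_of_le_right {x y y' z : E} (hy : y ≤ y') (h : osum x y' = some z) :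
    ∃ w, osum x y = some w ∧ w ≤ z := by
  obtain ⟨d, hd⟩ := hy
  obtain ⟨w, hw, hw'⟩ := osum_assoc' hd h
  exact ⟨w, hw, le_of_osum_left hw'⟩

theorem exists_osum_of_le {x x' y y' z : E} (hx : x ≤ x') (hy : y ≤ y')
    (h : osum x' y' = some z) : ∃ w, osum x y = some w ∧ w ≤ z := by
  obtain ⟨w, hw, hwz⟩ := exists_osum_of_le_right hy h
  obtain ⟨v, hv, hvw⟩ := exists_osum_of_le_right hx (osum_comm _ _ _ hw)
  exact ⟨v, osum_comm _ _ _ hv, hvw.trans hwz⟩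

theorem le_of_osum_le_osum {x y z s t : E} (h : osum x y = some s) (h' : osum x z = some t)
    (hst : s ≤ t) : y ≤ z := by
  obtain ⟨d, hd⟩ := hst
  obtain ⟨u, hu, hu'⟩ := osum_assoc x y d s t h hd
  rw [osum_left_cancel h' hu']
  exact le_of_osum_left hu

/-- An element that can be doubled indefinitely is zero. -/
theorem eq_zero_of_doubling (hE : IsOmegaComplete E) (g : ℕ → E)
    (hg : ∀ n, osum (g n) (g n) = some (g (n + 1))) : g 0 = 0 := by
  have hmono : Monotone g := monotone_nat_of_le_succ fun n => le_of_osum_left (hg n)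
  obtain ⟨s, hs⟩ := hE g hmono
  obtain ⟨r, hr⟩ := hs.1 ⟨0, rfl⟩
  -- Cancel `g 0` in `g 0 ⊕ g n ≤ g n ⊕ g n = g (n + 1) ≤ s = g 0 ⊕ r`: the remainder `r` bounds
  -- every `g n`.
  have hsr : s ≤ r := by
    refine hs.2 ?_
    rintro _ ⟨n, rfl⟩
    obtain ⟨w, hw, hwn⟩ := exists_osum_of_le (hmono (Nat.zero_le n)) le_rfl (hg n)
    exact le_of_osum_le_osum hw hr (hwn.trans (hs.1 ⟨n + 1, rfl⟩))
  have hrs : r = s := le_antisymm (le_of_osum_right hr) hsr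
  rw [hrs] at hr
  exact eq_zero_of_osum_self (osum_comm _ _ _ hr)

/-- In an `ω`-complete effect algebra, an element below every term of a sequence of successive
halves is zero. -/
theorem eq_zero_of_le_halves (hE : IsOmegaComplete E) (c : ℕ → E)
    (hc : ∀ n, osum (c (n + 1)) (c (n + 1)) = some (c n)) {d : E} (hd : ∀ n, d ≤ c n) :
    d = 0 := by
  -- Lower bounds of `c` are closed under doubling: `x ≤ c (n + 1)` gives `x ⊕ x ≤ c n`.
  have hdouble : ∀ x : {x : E // ∀ n, x ≤ c n}, ∃ y : {x : E // ∀ n, x ≤ c n},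
      osum x.1 x.1 = some y.1 := by
    rintro ⟨x, hx⟩
    obtain ⟨w, hw, -⟩ := exists_osum_of_le (hx 1) (hx 1) (hc 0)
    refine ⟨⟨w, fun n => ?_⟩, hw⟩
    obtain ⟨w', hw', hle⟩ := exists_osum_of_le (hx (n + 1)) (hx (n + 1)) (hc n)
    rw [hw] at hw'
    cases hw'
    exact hle
  choose f hf using hdouble
  refine eq_zero_of_doubling hE (fun n => (f^[n] ⟨d, hd⟩).1) fun n => ?_
  rw [Function.iterate_succ_apply']
  exact hf _

/-- A map from the unit interval that takes sums to sums. -/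
def IsAdditive (φ : unitInterval → E) : Prop :=
  ∀ l m n : unitInterval, (l : ℝ) + m = n → osum (φ l) (φ m) = some (φ n)

theorem IsAdditive.mono {φ : unitInterval → E} (hφ : IsAdditive φ) : Monotone φ := by
  intro l m h
  have h' : (l : ℝ) ≤ m := h
  exact le_of_osum_left (hφ l ⟨(m : ℝ) - l, by linarith, by linarith [m.2.2, l.2.1]⟩ m (by simp))

theorem additive_halves {φ : unitInterval → E} (hφ : IsAdditive φ) (k : ℕ) :
    osum (φ (unitInterval.dyadic 1 (k + 1) Nat.one_le_two_pow))
      (φ (unitInterval.dyadic 1 (k + 1) Nat.one_le_two_pow)) =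
      some (φ (unitInterval.dyadic 1 k Nat.one_le_two_pow)) := by
  apply hφ
  simp only [unitInterval.dyadic, pow_succ]
  field_simp
  norm_num

theorem additive_zero {φ : unitInterval → E} (hφ : IsAdditive φ) : φ 0 = 0 :=
  eq_zero_of_osum_self (hφ 0 0 0 (by simp))

theorem floor_le_two_pow (l : unitInterval) (k : ℕ) : ⌊(l : ℝ) * 2 ^ k⌋₊ ≤ 2 ^ k := by
  apply Nat.floor_le_of_le
  push_cast
  exact mul_le_of_le_one_left (by positivity) l.2.2

/-- The dyadic approximation from below, with denominator `2 ^ k`. -/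
noncomputable def dyadicFloor (l : unitInterval) (k : ℕ) : unitInterval :=
  unitInterval.dyadic ⌊(l : ℝ) * 2 ^ k⌋₊ k (floor_le_two_pow l k)

theorem dyadicFloor_le (l : unitInterval) (k : ℕ) : (dyadicFloor l k : ℝ) ≤ l := by
  have h := Nat.floor_le (mul_nonneg l.2.1 (by positivity : (0 : ℝ) ≤ 2 ^ k))
  simp only [dyadicFloor, unitInterval.dyadic]
  rwa [div_le_iff₀ (by positivity)]

theorem sub_dyadicFloor_le (l : unitInterval) (k : ℕ) :
    (l : ℝ) - dyadicFloor l k ≤ unitInterval.dyadic 1 k Nat.one_le_two_pow := by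
  have h := Nat.lt_floor_add_one ((l : ℝ) * 2 ^ k)
  simp only [dyadicFloor, unitInterval.dyadic]
  rw [sub_le_iff_le_add, ← add_div, le_div_iff₀ (by positivity)]
  push_cast
  linarith

theorem dyadicFloor_monotone (l : unitInterval) : Monotone (dyadicFloor l) := by
  refine monotone_nat_of_le_succ fun k => ?_
  change (dyadicFloor l k : ℝ) ≤ dyadicFloor l (k + 1)
  simp only [dyadicFloor, unitInterval.dyadic]
  rw [div_le_div_iff₀ (by positivity) (by positivity), pow_succ]
  have h1 := Nat.floor_le (mul_nonneg l.2.1 (by positivity : (0 : ℝ) ≤ 2 ^ k))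
  have h2 : 2 * ⌊(l : ℝ) * 2 ^ k⌋₊ ≤ ⌊(l : ℝ) * (2 ^ k * 2)⌋₊ := by
    apply Nat.le_floor
    push_cast
    linarith
  have h3 : (2 : ℝ) * ⌊(l : ℝ) * 2 ^ k⌋₊ ≤ ⌊(l : ℝ) * (2 ^ k * 2)⌋₊ := by exact_mod_cast h2
  have h4 : (0 : ℝ) ≤ 2 ^ k := by positivity
  nlinarith

/-- Additive maps into an `ω`-complete effect algebra are continuous from below. -/
theorem additive_eq_of_isLUB (hE : IsOmegaComplete E) {φ : unitInterval → E} (hφ : IsAdditive φ)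
    (l : unitInterval) {s : E} (hs : IsLUB (Set.range fun k => φ (dyadicFloor l k)) s) :
    φ l = s := by
  have hsl : s ≤ φ l := by
    refine hs.2 ?_
    rintro _ ⟨k, rfl⟩
    exact hφ.mono (dyadicFloor_le l k)
  obtain ⟨d, hd⟩ := hsl
  have hd0 : d = 0 := by
    refine eq_zero_of_le_halves hE
      (fun k => φ (unitInterval.dyadic 1 k Nat.one_le_two_pow)) (additive_halves hφ) fun k => ?_
    -- Cancelling `φ (dyadicFloor l k)` from `φ l` gives `t ⊕ d = φ r` with `r ≤ 1 / 2 ^ k`, so the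
    -- gap `d` lies below `φ (1 / 2 ^ k)`.
    obtain ⟨t, ht⟩ := hs.1 ⟨k, rfl⟩
    obtain ⟨u, hu, hu'⟩ := osum_assoc _ t d s (φ l) ht hd
    let r : unitInterval := ⟨(l : ℝ) - dyadicFloor l k, sub_nonneg.2 (dyadicFloor_le l k), by
      linarith [l.2.2, (dyadicFloor l k).2.1]⟩
    have hr := hφ (dyadicFloor l k) r l (by simp [r])
    rw [osum_left_cancel hu' hr] at hu
    exact (le_of_osum_right hu).trans (hφ.mono (sub_dyadicFloor_le l k))
  rw [hd0, osum_zero] at hd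
  exact (Option.some.inj hd).symm

end EffectAlgebra

namespace ConvexAction

open EffectAlgebra

variable {E : Type*} [EffectAlgebra E] [ConvexAction E]

theorem isAdditive_smul (a : E) : IsAdditive fun l : unitInterval => l • a := by
  intro l m n h
  rw [osum_smul l m a (h ▸ n.2.2)]
  exact congrArg (fun t : unitInterval => some (t • a)) (Subtype.ext h)

/-- In a convex effect algebra halves are unique. -/
theorem osum_self_injective {x y z : E} (hx : osum x x = some z) (hy : osum y y = some z) :
    x = y := by
  -- The action forces the half: `(1/2) z = (1/2) w ⊕ (1/2) w = w`.
  have key : ∀ w : E, osum w w = some z → (unitInterval.dyadic 1 1 (by simp)) • z = w := by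
    intro w hw
    have h1 := smul_osum (unitInterval.dyadic 1 1 (by simp)) w w z hw
    have h2 := isAdditive_smul w (unitInterval.dyadic 1 1 (by simp))
      (unitInterval.dyadic 1 1 (by simp)) 1 (by simp [unitInterval.dyadic]; norm_num)
    simp only [h2, one_smul] at h1
    exact (Option.some.inj h1).symm
  rw [← key x hx, key y hy]

theorem additive_inv_two_pow {φ ψ : unitInterval → E} (hφ : IsAdditive φ) (hψ : IsAdditive ψ)
    (h : φ 1 = ψ 1) (k : ℕ) :
    φ (unitInterval.dyadic 1 k Nat.one_le_two_pow) =
      ψ (unitInterval.dyadic 1 k Nat.one_le_two_pow) := by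
  induction k with
  | zero =>
    have : unitInterval.dyadic 1 0 Nat.one_le_two_pow = 1 := Subtype.ext (by
      simp [unitInterval.dyadic])
    rw [this, h]
  | succ k ih =>
    have h1 := additive_halves hφ k
    rw [ih] at h1
    exact osum_self_injective h1 (additive_halves hψ k)

theorem additive_dyadic {φ ψ : unitInterval → E} (hφ : IsAdditive φ) (hψ : IsAdditive ψ)
    (h : φ 1 = ψ 1) (k m : ℕ) (hm : m ≤ 2 ^ k) :
    φ (unitInterval.dyadic m k hm) = ψ (unitInterval.dyadic m k hm) := by
  induction m with
  | zero =>
    have : unitInterval.dyadic 0 k hm = 0 := Subtype.ext (by simp [unitInterval.dyadic])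
    rw [this, additive_zero hφ, additive_zero hψ]
  | succ m ih =>
    have hadd : ((unitInterval.dyadic m k (by omega) : unitInterval) : ℝ) +
        unitInterval.dyadic 1 k Nat.one_le_two_pow = unitInterval.dyadic (m + 1) k hm := by
      simp only [unitInterval.dyadic]
      push_cast
      ring
    have h1 := hφ _ _ _ hadd
    rw [ih, additive_inv_two_pow hφ hψ h, hψ _ _ _ hadd] at h1
    exact (Option.some.inj h1).symm

/-- Additive maps on the unit interval into an `ω`-complete convex effect algebra are determined
by their value at `1`. -/
theorem additive_ext (hE : IsOmegaComplete E) {φ ψ : unitInterval → E} (hφ : IsAdditive φ)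
    (hψ : IsAdditive ψ) (h : φ 1 = ψ 1) : φ = ψ := by
  funext l
  obtain ⟨s, hs⟩ := hE (fun k => φ (dyadicFloor l k)) (hφ.mono.comp (dyadicFloor_monotone l))
  rw [additive_eq_of_isLUB hE hφ l hs]
  -- Agreement on dyadics makes `s` the supremum for `ψ` as well.
  have hfun : (fun k => φ (dyadicFloor l k)) = fun k => ψ (dyadicFloor l k) :=
    funext fun k => additive_dyadic hφ hψ h k _ _
  rw [hfun] at hs
  exact (additive_eq_of_isLUB hE hψ l hs).symm

end ConvexAction

theorem mainTheorem13 {M : Type*} [EffectMonoid M] [ConvexAction M]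
    (hM : EffectAlgebra.IsOmegaComplete M) (l : unitInterval) (a b : M) :
    l • (a * b) = (l • a) * b ∧ (l • a) * b = a * (l • b) := by
  have hleft : EffectAlgebra.IsAdditive fun l : unitInterval => (l • a) * b := fun l m n h =>
    EffectMonoid.osum_mul _ _ _ _ (ConvexAction.isAdditive_smul a l m n h)
  have hright : EffectAlgebra.IsAdditive fun l : unitInterval => a * (l • b) := fun l m n h =>
    EffectMonoid.mul_osum _ _ _ _ (ConvexAction.isAdditive_smul b l m n h)
  exact ⟨congrFun (ConvexAction.additive_ext hM (ConvexAction.isAdditive_smul (a * b)) hleft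
      (by simp only [ConvexAction.one_smul])) l,
    congrFun (ConvexAction.additive_ext hM hleft hright
      (by simp only [ConvexAction.one_smul])) l⟩
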